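/- For a sequence $\mathcal{D}=(d_1,\dots,d_n)$ of positive integers that is feasible (that is, there is a simple graph on $\{1,\dots,n\}$ in which vertex $i$ has degree $d_i$ for every $i$), let $G(\mathcal{D})$ be a uniformly random graph among all simple graphs on $\{1,\dots,n\}$ in which vertex $i$ has degree $d_i$ for every $i$, and let $M_{\mathcal{D}}=\sum_{i:\,d_i\neq 2}d_i$. For every real $b\ge 0$ and every $0<\gamma<\frac18$ there exist a positive integer $n_{b,\gamma}$ and a real number $0<\delta<1$ such that for every $n>n_{b,\gamma}$ and every feasible sequence $\mathcal{D}$ of $n$ positive integers with $M_{\mathcal{D}}\le b$, $$\delta\;\le\;\mathbb{P}\bigl[\,G(\mathcal{D})\text{ has a connected component with at least }\gamma n\text{ vertices}\,\bigr]\;\le\;1-\delta .$$ -/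

import Mathlib

namespace RandomDegreeGraph

/-- The simple graphs on the vertex set `Fin n` in which every vertex `i` has degree `D i`. -/
def realizations {n : ℕ} (D : Fin n → ℕ) : Set (SimpleGraph (Fin n)) :=
  {G | ∀ i, (G.neighborSet i).ncard = D i}

/-- A degree sequence is feasible if some simple graph has it as its degree sequence. -/
def Feasible {n : ℕ} (D : Fin n → ℕ) : Prop :=
  (realizations D).Nonempty

/-- The sum of the degrees that are different from `2`. -/
def sumDegNeTwo {n : ℕ} (D : Fin n → ℕ) : ℕ :=
  ∑ i ∈ Finset.univ.filter (fun i => D i ≠ 2), D i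

/-- The probability that a uniformly chosen simple graph with degree sequence `D` has the
property `P`: the proportion of the graphs with degree sequence `D` that satisfy `P`. It is
meaningful for feasible `D`. -/
noncomputable def prob {n : ℕ} (D : Fin n → ℕ) (P : SimpleGraph (Fin n) → Prop) : ℝ :=
  ((realizations D ∩ {G | P G}).ncard : ℝ) / ((realizations D).ncard : ℝ)

/-- `G` has a connected component with at least `x` vertices. -/
def HasComponentOfOrderAtLeast {n : ℕ} (x : ℝ) (G : SimpleGraph (Fin n)) : Prop :=
  ∃ c : G.ConnectedComponent, x ≤ (c.supp.ncard : ℝ)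

end RandomDegreeGraph

/-!
A switch replaces two edges `uv`, `xy` by `ux`, `vy`. Each realization is the outcome of at most
`(∑ d i) ^ 2 = O(n ^ 2)` switches, so if every graph in a set `A` of realizations has `Ω(n ^ 2)`
switches into a set `B`, then `|A| = O(|B|)`. All but boundedly many vertices have degree `2`, so
most of the graph consists of long paths and cycles of vertices of degree `2`.

* A positive proportion has no large component: a large component contains a path of linearly many
  vertices of degree `2`, and `Ω(n ^ 2)` switches of two of its edges cut off a cycle of linear
  size that is still too small to count as large. This removes linearly many vertices from the
  large components, so boundedly many rounds remove them all.
* A positive proportion has a large component: in at least half of the realizations at most a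
  quarter of the vertices lie on short cycles, since each vertex does so with probability at most
  `1 / 8`. Such a realization contains a large bounded number of disjoint paths of linear length,
  all of degree `2`. Merging them one after another, each time by `Ω(n ^ 2)` switches, yields a path
  with at least `n / 8` vertices.
-/

namespace RandomDegreeGraph

section Counting

theorem ncard_mul_le_ncard_mul_of_labels {α β τ : Type*} [Finite α] [Finite β] [Finite τ]
    {A : Set α} {B : Set β} (r : α → τ → β → Prop) {p q : ℕ}
    (hout : ∀ a ∈ A, p ≤ {t | ∃ b ∈ B, r a t b}.ncard)
    (hin : ∀ b ∈ B, {t | ∃ a ∈ A, r a t b}.ncard ≤ q)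
    (hinj : ∀ a a' t b, r a t b → r a' t b → a = a') :
    A.ncard * p ≤ B.ncard * q := by
  classical
  have := Fintype.ofFinite α
  have := Fintype.ofFinite β
  have := Fintype.ofFinite τ
  simp only [Set.ncard_eq_toFinset_card'] at hout hin ⊢
  let S := A.toFinset.sigma fun a => {t | ∃ b ∈ B, r a t b}.toFinset
  let T := B.toFinset.sigma fun b => {t | ∃ a ∈ A, r a t b}.toFinset
  have hST : S.card ≤ T.card := by
    refine Finset.card_le_card_of_forall_subsingleton
      (fun x y => x.2 = y.2 ∧ r x.1 x.2 y.1) ?_ ?_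
    · rintro ⟨a, t⟩ h
      simp only [S, Finset.mem_sigma, Set.mem_toFinset, Set.mem_ofPred_eq] at h
      obtain ⟨ha, b, hb, hr⟩ := h
      exact ⟨⟨b, t⟩, by simpa [T, hb] using ⟨a, ha, hr⟩, rfl, hr⟩
    · rintro ⟨b, t⟩ - ⟨a, s⟩ ⟨-, rfl, h⟩ ⟨a', s'⟩ ⟨-, rfl, h'⟩
      rw [hinj a a' s' b h h']
  calc A.toFinset.card * p ≤ S.card := by
        rw [Finset.card_sigma]
        exact Finset.card_nsmul_le_sum _ _ _ fun a ha => hout a (Set.mem_toFinset.1 ha)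
    _ ≤ T.card := hST
    _ ≤ B.toFinset.card * q := by
        rw [Finset.card_sigma]
        exact Finset.sum_le_card_nsmul _ _ _ fun b hb => hin b (Set.mem_toFinset.1 hb)

theorem mul_self_le_ncard {V : Type*} [Finite V] {S : Set (V × V × V × V)} {p q : ℕ → V}
    {k l i j t : ℕ} (hp : Set.InjOn p (Set.Iio k)) (hq : Set.InjOn q (Set.Iio l))
    (hi : i + t < k) (hj : j + t < l)
    (hS : ∀ a < t, ∀ b < t, (p (i + a), p (i + a + 1), q (j + b + 1), q (j + b)) ∈ S) :
    t * t ≤ S.ncard := by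
  calc t * t = (Set.Iio t ×ˢ Set.Iio t).ncard := by rw [Set.ncard_prod, Set.ncard_Iio_nat]
    _ ≤ S.ncard := by
      refine Set.ncard_le_ncard_of_injOn
        (fun z => (p (i + z.1), p (i + z.1 + 1), q (j + z.2 + 1), q (j + z.2)))
        (fun z hz => hS z.1 hz.1 z.2 hz.2) ?_
      rintro ⟨a, b⟩ ⟨ha, hb⟩ ⟨a', b'⟩ ⟨ha', hb'⟩ he
      simp only [Prod.mk.injEq] at he
      simp only [Set.mem_Iio] at ha hb ha' hb'
      have ea := hp (by simp; omega) (by simp; omega) he.1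
      have eb := hq (by simp; omega) (by simp; omega) he.2.2.2
      simp only [Prod.mk.injEq]
      omega

theorem ncard_le_pow_mul_of_ncard_diff_le {α : Type*} [Finite α] {A : ℕ → Set α} {C : ℕ}
    (h : ∀ j, (A (j + 1) \ A j).ncard ≤ C * (A j).ncard) (j : ℕ) :
    (A j).ncard ≤ (1 + C) ^ j * (A 0).ncard := by
  induction j with
  | zero => simp
  | succ j ih =>
    calc (A (j + 1)).ncard ≤ (A (j + 1) \ A j).ncard + (A j).ncard :=
          Set.ncard_le_ncard_sdiff_add_ncard _ _
      _ ≤ (1 + C) * (A j).ncard := by linarith [h j]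
      _ ≤ (1 + C) * ((1 + C) ^ j * (A 0).ncard) := Nat.mul_le_mul_left _ ih
      _ = (1 + C) ^ (j + 1) * (A 0).ncard := by ring

end Counting

section Switch

variable {V : Type*} {G : SimpleGraph V} {u v x y : V}

/-- The switch of the edges `uv` and `xy`: they are replaced by `ux` and `vy`. This is the
operation that connects the realizations of a degree sequence. -/
def switch (G : SimpleGraph V) (u v x y : V) : SimpleGraph V :=
  G.deleteEdges {s(u, v), s(x, y)} ⊔ SimpleGraph.fromEdgeSet {s(u, x), s(v, y)}

/-- The switch at `(u, v, x, y)` preserves degrees: it replaces two edges by two non-edges. -/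
structure CanSwitch (G : SimpleGraph V) (u v x y : V) : Prop where
  uv : G.Adj u v
  xy : G.Adj x y
  ux : ¬ G.Adj u x
  vy : ¬ G.Adj v y
  ne_ux : u ≠ x
  ne_vy : v ≠ y

theorem switch_adj {a b : V} : (switch G u v x y).Adj a b ↔
    (G.Adj a b ∧ s(a, b) ≠ s(u, v) ∧ s(a, b) ≠ s(x, y)) ∨
      (s(a, b) = s(u, x) ∨ s(a, b) = s(v, y)) ∧ a ≠ b := by
  simp only [switch, SimpleGraph.sup_adj, SimpleGraph.deleteEdges_adj,
    SimpleGraph.fromEdgeSet_adj, Set.mem_insert_iff, Set.mem_singleton_iff, not_or, ne_eq]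

theorem switch_swap_ends (G : SimpleGraph V) (u v x y : V) :
    switch G v u y x = switch G u v x y := by
  rw [switch, switch, Sym2.eq_swap (a := v), Sym2.eq_swap (a := y), Set.pair_comm s(v, y)]

theorem switch_swap_edges (G : SimpleGraph V) (u v x y : V) :
    switch G x y u v = switch G u v x y := by
  rw [switch, switch, Sym2.eq_swap (a := x) (b := u), Sym2.eq_swap (a := y) (b := v),
    Set.pair_comm s(x, y)]

namespace CanSwitch

theorem ne_uy (h : CanSwitch G u v x y) : u ≠ y := by
  rintro rfl
  exact h.ux h.xy.symm

theorem swap_ends (h : CanSwitch G u v x y) : CanSwitch G v u y x :=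
  ⟨h.uv.symm, h.xy.symm, h.vy, h.ux, h.ne_vy, h.ne_ux⟩

theorem swap_edges (h : CanSwitch G u v x y) : CanSwitch G x y u v :=
  ⟨h.xy, h.uv, fun e => h.ux e.symm, fun e => h.vy e.symm, h.ne_ux.symm, h.ne_vy.symm⟩

theorem adj_ux (h : CanSwitch G u v x y) : (switch G u v x y).Adj u x :=
  switch_adj.2 (Or.inr ⟨Or.inl rfl, h.ne_ux⟩)

theorem adj_vy (h : CanSwitch G u v x y) : (switch G u v x y).Adj v y :=
  switch_adj.2 (Or.inr ⟨Or.inr rfl, h.ne_vy⟩)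

theorem switch_switch (h : CanSwitch G u v x y) : switch (switch G u v x y) u x v y = G := by
  have huv := h.uv
  have hxy := h.xy
  have hux := h.ux
  have hvy := h.vy
  ext a b
  have hab := G.ne_of_adj (a := a) (b := b)
  simp only [switch_adj, Sym2.eq_iff, ne_eq]
  grind [SimpleGraph.adj_comm, SimpleGraph.irrefl]

theorem neighborSet_switch_self (h : CanSwitch G u v x y) :
    (switch G u v x y).neighborSet u = insert x (G.neighborSet u \ {v}) := by
  have hux := h.ne_ux
  have huv := h.uv.ne
  have huy := h.ne_uy
  ext b
  simp only [SimpleGraph.mem_neighborSet, switch_adj, Sym2.eq_iff, Set.mem_insert_iff,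
    Set.mem_sdiff, Set.mem_singleton_iff]
  grind

theorem ncard_neighborSet_switch_self (h : CanSwitch G u v x y) :
    ((switch G u v x y).neighborSet u).ncard = (G.neighborSet u).ncard := by
  rw [h.neighborSet_switch_self]
  exact Set.ncard_exchange h.ux h.uv

theorem ncard_neighborSet_switch (h : CanSwitch G u v x y) (a : V) :
    ((switch G u v x y).neighborSet a).ncard = (G.neighborSet a).ncard := by
  by_cases hu : a = u
  · exact hu ▸ h.ncard_neighborSet_switch_self
  by_cases hv : a = v
  · rw [← switch_swap_ends, hv]
    exact h.swap_ends.ncard_neighborSet_switch_self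
  by_cases hx : a = x
  · rw [← switch_swap_edges, hx]
    exact h.swap_edges.ncard_neighborSet_switch_self
  by_cases hy : a = y
  · rw [← switch_swap_edges, ← switch_swap_ends, hy]
    exact h.swap_edges.swap_ends.ncard_neighborSet_switch_self
  have hN : (switch G u v x y).neighborSet a = G.neighborSet a := by
    ext b
    simp [switch_adj, hu, hv, hx, hy]
  rw [hN]

end CanSwitch

theorem reachable_of_reachable_switch {a b : V} (huv : G.Adj u v) (hxy : G.Adj x y)
    (hux : G.Reachable u x) (h : (switch G u v x y).Reachable a b) : G.Reachable a b := by
  have hvy : G.Reachable v y := huv.symm.reachable.trans (hux.trans hxy.reachable)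
  induction (SimpleGraph.reachable_iff_reflTransGen a b).1 h with
  | refl => rfl
  | tail hac hcd ih =>
    refine (ih ((SimpleGraph.reachable_iff_reflTransGen _ _).2 hac)).trans ?_
    rcases switch_adj.1 hcd with h | ⟨h | h, -⟩
    · exact h.1.reachable
    · rcases Sym2.eq_iff.1 h with ⟨rfl, rfl⟩ | ⟨rfl, rfl⟩
      exacts [hux, hux.symm]
    · rcases Sym2.eq_iff.1 h with ⟨rfl, rfl⟩ | ⟨rfl, rfl⟩
      exacts [hvy, hvy.symm]

end Switch

section Realizations

variable {n : ℕ} {D : Fin n → ℕ} {G : SimpleGraph (Fin n)}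

theorem CanSwitch.switch_mem_realizations {u v x y : Fin n} (h : CanSwitch G u v x y)
    (hG : G ∈ realizations D) : switch G u v x y ∈ realizations D :=
  fun i => (h.ncard_neighborSet_switch i).trans (hG i)

theorem ncard_darts_eq_sum (hG : G ∈ realizations D) (S : Finset (Fin n)) :
    {z : Fin n × Fin n | z.1 ∈ S ∧ G.Adj z.1 z.2}.ncard = ∑ i ∈ S, D i := by
  classical
  have hS : {z : Fin n × Fin n | z.1 ∈ S ∧ G.Adj z.1 z.2}.toFinset.card =
      (S.sigma fun i => (G.neighborSet i).toFinset).card :=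
    Finset.card_bij' (fun z _ => ⟨z.1, z.2⟩) (fun z _ => (z.1, z.2)) (by simp) (by simp)
      (by simp) (by simp)
  rw [Set.ncard_eq_toFinset_card', hS, Finset.card_sigma]
  exact Finset.sum_congr rfl fun i _ => by rw [← hG i, Set.ncard_eq_toFinset_card']

theorem ncard_edge_pairs_le (hG : G ∈ realizations D) :
    {(u, v, x, y) : Fin n × Fin n × Fin n × Fin n | G.Adj u x ∧ G.Adj v y}.ncard ≤
      (∑ i, D i) * ∑ i, D i := by
  have h := ncard_darts_eq_sum hG Finset.univ
  simp only [Finset.mem_univ, true_and] at h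
  rw [← h, ← Set.ncard_prod]
  refine Set.ncard_le_ncard_of_injOn (fun t => ((t.1, t.2.2.1), (t.2.1, t.2.2.2)))
    (fun _ ht => ht) ?_
  rintro ⟨u, v, x, y⟩ - ⟨u', v', x', y'⟩ - he
  simp_all only [Prod.mk.injEq]

/-- The switches of `G` whose outcome lies in `B`, as quadruples `(u, v, x, y)`. -/
def switchesInto {V : Type*} (B : Set (SimpleGraph V)) (G : SimpleGraph V) :
    Set (V × V × V × V) :=
  {(u, v, x, y) | CanSwitch G u v x y ∧ switch G u v x y ∈ B}

variable {A B : Set (SimpleGraph (Fin n))} {p C t : ℕ}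

theorem ncard_mul_le_of_switch (hB : B ⊆ realizations D)
    (hA : ∀ G ∈ A, p ≤ (switchesInto B G).ncard) :
    A.ncard * p ≤ B.ncard * ((∑ i, D i) * ∑ i, D i) := by
  refine ncard_mul_le_ncard_mul_of_labels
    (fun G (u, v, x, y) H => CanSwitch G u v x y ∧ switch G u v x y = H) ?_ ?_ ?_
  · intro G hG
    simpa [switchesInto, and_comm] using hA G hG
  · intro H hH
    refine (Set.ncard_le_ncard ?_).trans (ncard_edge_pairs_le (hB hH))
    rintro ⟨u, v, x, y⟩ ⟨G, -, hs, rfl⟩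
    exact ⟨hs.adj_ux, hs.adj_vy⟩
  · rintro G G' ⟨u, v, x, y⟩ H ⟨hs, h⟩ ⟨hs', h'⟩
    rw [← hs.switch_switch, ← hs'.switch_switch, h, h']

theorem ncard_le_mul_of_switch (hB : B ⊆ realizations D) (ht : 0 < t)
    (hC : (∑ i, D i) * ∑ i, D i ≤ C * (t * t))
    (hA : ∀ G ∈ A, t * t ≤ (switchesInto B G).ncard) : A.ncard ≤ C * B.ncard := by
  refine Nat.le_of_mul_le_mul_right ?_ (Nat.mul_pos ht ht)
  calc A.ncard * (t * t) ≤ B.ncard * ((∑ i, D i) * ∑ i, D i) := ncard_mul_le_of_switch hB hA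
    _ ≤ B.ncard * (C * (t * t)) := Nat.mul_le_mul_left _ hC
    _ = C * B.ncard * (t * t) := by ring

end Realizations

section DegTwoPath

variable {V : Type*} {G : SimpleGraph V} {p q : ℕ → V} {i j k l m : ℕ}

theorem eq_or_eq_of_adj_of_adj {w a c d : V} (hw : (G.neighborSet w).ncard = 2)
    (ha : G.Adj w a) (hc : G.Adj w c) (hac : a ≠ c) (hd : G.Adj w d) : d = a ∨ d = c := by
  obtain ⟨s, t, -, hN⟩ := Set.ncard_eq_two.1 hw
  have hadj : ∀ z, G.Adj w z ↔ z = s ∨ z = t := fun z => by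
    rw [← G.mem_neighborSet, hN, Set.mem_insert_iff, Set.mem_singleton_iff]
  grind

/-- `p 0, …, p (k - 1)` is a path of `G` all of whose vertices have degree `2` in `G`. The later
values of `p` are irrelevant; a function on `ℕ` makes it easy to cut and join paths. -/
structure IsDegTwoPath (G : SimpleGraph V) (p : ℕ → V) (k : ℕ) : Prop where
  deg : ∀ i < k, (G.neighborSet (p i)).ncard = 2
  adj : ∀ i, i + 1 < k → G.Adj (p i) (p (i + 1))
  inj : ∀ i < k, ∀ j < k, p i = p j → i = j

namespace IsDegTwoPath

theorem injOn (h : IsDegTwoPath G p k) : Set.InjOn p (Set.Iio k) :=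
  fun i hi j hj => h.inj i hi j hj

theorem ncard_image (h : IsDegTwoPath G p k) : (p '' Set.Iio k).ncard = k := by
  rw [h.injOn.ncard_image, Set.ncard_Iio_nat]

theorem single {v : V} (hv : (G.neighborSet v).ncard = 2) : IsDegTwoPath G (fun _ => v) 1 :=
  ⟨fun _ _ => hv, fun i hi => by omega, fun i hi j hj _ => by omega⟩

theorem mono (h : IsDegTwoPath G p k) (hl : l ≤ k) : IsDegTwoPath G p l :=
  ⟨fun i hi => h.deg i (by omega), fun i hi => h.adj i (by omega),
    fun i hi j hj => h.inj i (by omega) j (by omega)⟩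

theorem drop (h : IsDegTwoPath G p k) (m : ℕ) : IsDegTwoPath G (fun s => p (m + s)) (k - m) :=
  ⟨fun i hi => h.deg _ (by omega), fun i hi => h.adj (m + i) (by omega), fun i hi j hj he => by
    have := h.inj _ (by omega) _ (by omega) he
    omega⟩

theorem reverse (h : IsDegTwoPath G p k) : IsDegTwoPath G (fun i => p (k - 1 - i)) k := by
  refine ⟨fun i hi => h.deg _ (by omega), fun i hi => ?_, fun i hi j hj he => ?_⟩
  · have := h.adj (k - 1 - (i + 1)) (by omega)
    rw [show k - 1 - (i + 1) + 1 = k - 1 - i by omega] at this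
    exact this.symm
  · have := h.inj _ (by omega) _ (by omega) he
    omega

theorem append (hp : IsDegTwoPath G p k) (hq : IsDegTwoPath G q l) (hadj : G.Adj (p (k - 1)) (q 0))
    (hpq : ∀ i < k, ∀ j < l, p i ≠ q j) :
    IsDegTwoPath G (fun s => if s < k then p s else q (s - k)) (k + l) := by
  refine ⟨fun i hi => ?_, fun i hi => ?_, fun i hi j hj he => ?_⟩
  · split_ifs with h
    exacts [hp.deg i h, hq.deg _ (by omega)]
  · rcases lt_trichotomy (i + 1) k with h | rfl | h
    · simpa [h, show i < k by omega] using hp.adj i h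
    · simpa using hadj
    · simpa [show ¬ i < k by omega, show ¬ i + 1 < k by omega,
        Nat.sub_add_comm (Nat.lt_succ_iff.1 h)] using hq.adj (i - k) (by omega)
  · split_ifs at he with h h' h'
    · exact hp.inj i h j h' he
    · exact absurd he (hpq i h _ (by omega))
    · exact absurd he.symm (hpq j h' _ (by omega))
    · have := hq.inj _ (by omega) _ (by omega) he
      omega

protected theorem switch {u v x y : V} (h : IsDegTwoPath G p k) (hs : CanSwitch G u v x y)
    (huv : ∀ i, i + 1 < k → s(p i, p (i + 1)) ≠ s(u, v))
    (hxy : ∀ i, i + 1 < k → s(p i, p (i + 1)) ≠ s(x, y)) :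
    IsDegTwoPath (switch G u v x y) p k :=
  ⟨fun i hi => (hs.ncard_neighborSet_switch _).trans (h.deg i hi),
    fun i hi => switch_adj.2 (Or.inl ⟨h.adj i hi, huv i hi, hxy i hi⟩), h.inj⟩

theorem eq_of_edge_eq (h : IsDegTwoPath G p k) (hi : i + 1 < k) (hj : j + 1 < k)
    (he : s(p i, p (i + 1)) = s(p j, p (j + 1))) : i = j := by
  rcases Sym2.eq_iff.1 he with ⟨e, -⟩ | ⟨e, e'⟩
  · exact h.inj _ (by omega) _ (by omega) e
  · have := h.inj _ (by omega) _ (by omega) e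
    have := h.inj _ (by omega) _ (by omega) e'
    omega

theorem reachable (h : IsDegTwoPath G p k) (hi : i < k) (hj : j < k) :
    G.Reachable (p i) (p j) := by
  have hzero : ∀ m < k, G.Reachable (p 0) (p m) := by
    intro m
    induction m with
    | zero => exact fun _ => SimpleGraph.Reachable.refl _
    | succ m ih => exact fun hm => (ih (by omega)).trans (h.adj m hm).reachable
  exact (hzero i hi).symm.trans (hzero j hj)

theorem eq_or_eq_of_adj (h : IsDegTwoPath G p k) (hi : i + 2 < k) {z : V}
    (hz : G.Adj (p (i + 1)) z) : z = p i ∨ z = p (i + 2) := by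
  refine eq_or_eq_of_adj_of_adj (h.deg _ (by omega)) (h.adj i (by omega)).symm (h.adj _ hi) ?_ hz
  intro he
  have := h.inj _ (by omega) _ (by omega) he
  omega

theorem eq_of_adj_of_ne {a : V} (hp : IsDegTwoPath G p k) (hq : IsDegTwoPath G q k)
    (h0 : p 0 = q 0) (ha : G.Adj (p 0) a) (hpa : 1 < k → p 1 ≠ a) (hqa : 1 < k → q 1 ≠ a) :
    ∀ i < k, p i = q i := by
  intro i
  induction i using Nat.strong_induction_on with
  | _ i ih =>
    intro hi
    match i, ih, hi with
    | 0, _, _ => exact h0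
    | 1, _, hi =>
      have hq1 : G.Adj (p 0) (q 1) := h0 ▸ hq.adj 0 hi
      exact ((eq_or_eq_of_adj_of_adj (hp.deg 0 (by omega)) ha (hp.adj 0 hi) (hpa hi).symm
        hq1).resolve_left (hqa hi)).symm
    | i + 2, ih, hi =>
      have hqi : G.Adj (p (i + 1)) (q (i + 2)) := ih (i + 1) (by omega) (by omega) ▸ hq.adj _ hi
      rcases hp.eq_or_eq_of_adj hi hqi with h | h
      · rw [ih i (by omega) (by omega)] at h
        have := hq.inj _ (by omega) _ (by omega) h
        omega
      · exact h.symm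

end IsDegTwoPath

/-- `p 0, …, p (k - 1)` is a cycle of `G` all of whose vertices have degree `2`; in particular it
is a component of `G`. -/
structure IsDegTwoCycle (G : SimpleGraph V) (p : ℕ → V) (k : ℕ) : Prop where
  path : IsDegTwoPath G p k
  three_le : 3 ≤ k
  close : G.Adj (p (k - 1)) (p 0)

namespace IsDegTwoCycle

theorem mem_image_of_adj (h : IsDegTwoCycle G p k) {v z : V} (hv : v ∈ p '' Set.Iio k)
    (hz : G.Adj v z) : z ∈ p '' Set.Iio k := by
  have h3 := h.three_le
  obtain ⟨i, hi : i < k, rfl⟩ := hv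
  let prev := if i = 0 then k - 1 else i - 1
  let next := if i + 1 = k then 0 else i + 1
  have hprev_lt : prev < k := by grind
  have hnext_lt : next < k := by grind
  have hprev : G.Adj (p i) (p prev) := by
    rcases i with _ | i
    exacts [h.close.symm, (h.path.adj i hi).symm]
  have hnext : G.Adj (p i) (p next) := by
    by_cases hik : i + 1 = k
    · simpa [next, hik, ← Nat.eq_sub_of_add_eq hik] using h.close
    · simpa [next, hik] using h.path.adj i (by omega)
  have hne : p prev ≠ p next := fun he => by
    have := h.path.inj _ hprev_lt _ hnext_lt he
    grind
  rcases eq_or_eq_of_adj_of_adj (h.path.deg i hi) hprev hnext hne hz with rfl | rfl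
  exacts [⟨prev, hprev_lt, rfl⟩, ⟨next, hnext_lt, rfl⟩]

end IsDegTwoCycle

/-- The vertices reached from `w` by walking at most `l - 1` steps along vertices of degree `2`,
`w` included, without starting in the direction of `a`. -/
def ray (G : SimpleGraph V) (a w : V) (l : ℕ) : Set V :=
  {v | ∃ p j, j < l ∧ IsDegTwoPath G p (j + 1) ∧ p 0 = w ∧ (0 < j → p 1 ≠ a) ∧ p j = v}

theorem ncard_ray_le {a w : V} (h : G.Adj w a) (l : ℕ) : (ray G a w l).ncard ≤ l := by
  have hray : ∀ v ∈ ray G a w l, ∃ j, j < l ∧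
      ∃ p, IsDegTwoPath G p (j + 1) ∧ p 0 = w ∧ (0 < j → p 1 ≠ a) ∧ p j = v :=
    fun v ⟨p, j, hj, hp⟩ => ⟨j, hj, p, hp⟩
  choose! dist hlt hpath using hray
  refine (Set.ncard_le_ncard_of_injOn (t := Set.Iio l) dist hlt ?_).trans_eq (Set.ncard_Iio_nat l)
  intro v hv v' hv' he
  obtain ⟨p, hp, hp0, hpa, hpv⟩ := hpath v hv
  obtain ⟨q, hq, hq0, hqa, hqv⟩ := hpath v' hv'
  rw [← he] at hq hqa hqv
  rw [← hpv, ← hqv]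
  exact hp.eq_of_adj_of_ne hq (hp0.trans hq0.symm) (hp0 ▸ h) (fun _ => hpa (by omega))
    (fun _ => hqa (by omega)) _ (Nat.lt_succ_self _)

theorem IsDegTwoPath.mem_ray {a : V} (h : IsDegTwoPath G p (j + 1)) (hj : j < l)
    (ha : 0 < j → p (j - 1) ≠ a) : p 0 ∈ ray G a (p j) l :=
  ⟨_, j, hj, h.reverse, rfl, ha, by simp⟩

/-- The vertices of degree `2` at distance less than `l`, along vertices of degree `2`, from a
neighbour of a vertex of another degree. -/
def nearIrregular (G : SimpleGraph V) (l : ℕ) : Set V :=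
  ⋃ e ∈ {e : V × V | (G.neighborSet e.1).ncard ≠ 2 ∧ G.Adj e.1 e.2}, ray G e.1 e.2 l

/-- The vertices on cycles with fewer than `l` vertices, all of degree `2`. -/
def onShortCycle (G : SimpleGraph V) (l : ℕ) : Set V :=
  {v | ∃ p k, k < l ∧ IsDegTwoCycle G p k ∧ p 0 = v}

/-- The vertices at which a path of `l` vertices of degree `2` starts. -/
def pathStarts (G : SimpleGraph V) (l : ℕ) : Set V :=
  {v | ∃ p, IsDegTwoPath G p l ∧ p 0 = v}

theorem IsDegTwoPath.exists_extend (hp : IsDegTwoPath G p (m + 1)) (hm : m + 1 < l)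
    (hnear : p 0 ∉ nearIrregular G l) (hcyc : p 0 ∉ onShortCycle G l) :
    ∃ q, IsDegTwoPath G q (m + 2) ∧ q 0 = p 0 := by
  obtain ⟨y, hy : G.Adj (p m) y, hne⟩ := Set.exists_ne_of_one_lt_ncard
    (by rw [hp.deg m (by omega)]; omega : 1 < (G.neighborSet (p m)).ncard) (p (m - 1))
  have hdeg : (G.neighborSet y).ncard = 2 := by
    by_contra h
    exact hnear (Set.mem_biUnion (x := (y, p m)) ⟨h, hy.symm⟩
      (hp.mem_ray (by omega) fun _ => hne.symm))
  have hnew : ∀ i < m + 1, p i ≠ y := by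
    rintro i hi rfl
    have him : i ≠ m := fun h => G.irrefl (h ▸ hy : G.Adj (p m) (p m))
    have him' : i ≠ m - 1 := fun h => hne (by rw [h])
    rcases i with _ | i
    · exact hcyc ⟨p, m + 1, hm, ⟨hp, by omega, hy⟩, rfl⟩
    · rcases hp.eq_or_eq_of_adj (i := i) (by omega) hy.symm with h | h <;>
      · have := hp.inj _ (by omega) _ (by omega) h
        omega
  exact ⟨_, hp.append (.single hdeg) hy fun i hi _ _ => hnew i hi, by simp⟩

theorem mem_pathStarts {v : V} (hv : (G.neighborSet v).ncard = 2) (hl : 0 < l)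
    (hnear : v ∉ nearIrregular G l) (hcyc : v ∉ onShortCycle G l) : v ∈ pathStarts G l := by
  have hpath : ∀ m < l, ∃ p, IsDegTwoPath G p (m + 1) ∧ p 0 = v := by
    intro m
    induction m with
    | zero => exact fun _ => ⟨_, .single hv, rfl⟩
    | succ m ih =>
      intro hm
      obtain ⟨p, hp, rfl⟩ := ih (by omega)
      exact hp.exists_extend hm hnear hcyc
  obtain ⟨m, rfl⟩ := Nat.exists_eq_add_of_lt hl
  simpa [pathStarts] using hpath m (by omega)

theorem ncard_nearIrregular_le [Finite V] (G : SimpleGraph V) (l : ℕ) :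
    (nearIrregular G l).ncard ≤
      {e : V × V | (G.neighborSet e.1).ncard ≠ 2 ∧ G.Adj e.1 e.2}.ncard * l := by
  classical
  have := Fintype.ofFinite V
  let darts := {e : V × V | (G.neighborSet e.1).ncard ≠ 2 ∧ G.Adj e.1 e.2}
  calc (nearIrregular G l).ncard ≤ ∑ e ∈ darts.toFinset, (ray G e.1 e.2 l).ncard := by
        simpa [nearIrregular, darts] using
          Finset.set_ncard_biUnion_le darts.toFinset fun e => ray G e.1 e.2 l
    _ ≤ darts.toFinset.card * l := Finset.sum_le_card_nsmul _ _ _ fun e he =>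
        ncard_ray_le (Set.mem_toFinset.1 he).2.symm l
    _ = darts.ncard * l := by rw [Set.ncard_eq_toFinset_card']

end DegTwoPath

section PathStarts

variable {n : ℕ} {D : Fin n → ℕ} {G : SimpleGraph (Fin n)}

theorem ncard_ne_two_le_sumDegNeTwo (hD : ∀ i, 0 < D i) : {v | D v ≠ 2}.ncard ≤ sumDegNeTwo D := by
  rw [Set.ncard_eq_toFinset_card', sumDegNeTwo, Finset.card_eq_sum_ones, Set.toFinset_ofPred]
  exact Finset.sum_le_sum fun i _ => hD i

theorem ncard_nearIrregular_le_sumDegNeTwo_mul (hG : G ∈ realizations D) (l : ℕ) :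
    (nearIrregular G l).ncard ≤ sumDegNeTwo D * l := by
  rw [sumDegNeTwo, ← ncard_darts_eq_sum hG]
  simpa [hG _] using ncard_nearIrregular_le G l

theorem ncard_le_add_ncard_inter_pathStarts (hD : ∀ i, 0 < D i) (hG : G ∈ realizations D) {l : ℕ}
    (hl : 0 < l) (S : Set (Fin n)) :
    S.ncard ≤ sumDegNeTwo D * (l + 1) + (S ∩ onShortCycle G l).ncard +
      (S ∩ pathStarts G l).ncard := by
  have hsub : S ⊆ {v | D v ≠ 2} ∪ nearIrregular G l ∪ (S ∩ onShortCycle G l) ∪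
      (S ∩ pathStarts G l) := by
    intro v hv
    by_contra hc
    simp only [Set.mem_union, Set.mem_ofPred_eq, not_or, not_not, Set.mem_inter_iff, hv,
      true_and] at hc
    exact hc.2 (mem_pathStarts ((hG v).trans hc.1.1.1) hl hc.1.1.2 hc.1.2)
  calc S.ncard ≤ _ := Set.ncard_le_ncard hsub
    _ ≤ {v | D v ≠ 2}.ncard + (nearIrregular G l).ncard + (S ∩ onShortCycle G l).ncard +
        (S ∩ pathStarts G l).ncard := by
      grw [Set.ncard_union_le, Set.ncard_union_le, Set.ncard_union_le]
    _ ≤ sumDegNeTwo D + sumDegNeTwo D * l + (S ∩ onShortCycle G l).ncard +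
        (S ∩ pathStarts G l).ncard := by
      gcongr
      exacts [ncard_ne_two_le_sumDegNeTwo hD, ncard_nearIrregular_le_sumDegNeTwo_mul hG l]
    _ = _ := by ring

end PathStarts

section DegTwoFamily

variable {V : Type*} {G : SimpleGraph V} {p q : ℕ → V} {f : ℕ → ℕ → V} {j k l : ℕ}

/-- `f 0, …, f (k - 1)` are pairwise disjoint paths of `l` vertices of degree `2`. -/
structure IsDegTwoFamily (G : SimpleGraph V) (f : ℕ → ℕ → V) (k l : ℕ) : Prop where
  path : ∀ i < k, IsDegTwoPath G (f i) l
  disj : ∀ i < k, ∀ j < k, i ≠ j → ∀ a < l, ∀ c < l, f i a ≠ f j c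

namespace IsDegTwoFamily

theorem mono (h : IsDegTwoFamily G f k l) (hj : j ≤ k) : IsDegTwoFamily G f j l :=
  ⟨fun i hi => h.path i (by omega), fun i hi j hj => h.disj i (by omega) j (by omega)⟩

theorem update (h : IsDegTwoFamily G f k l) (hp : IsDegTwoPath G p l)
    (hpf : ∀ i < k, ∀ a < l, ∀ c < l, p a ≠ f i c) :
    IsDegTwoFamily G (Function.update f k p) (k + 1) l := by
  refine ⟨fun i hi => ?_, fun i hi j hj hij a ha c hc => ?_⟩
  · rcases eq_or_ne i k with rfl | hik
    · simpa using hp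
    · simpa [hik] using h.path i (by omega)
  · rcases eq_or_ne i k with hik | hik <;> rcases eq_or_ne j k with hjk | hjk
    · exact absurd (hik.trans hjk.symm) hij
    · simpa [hik, hjk] using hpf j (by omega) a ha c hc
    · simpa [hik, hjk] using (hpf i (by omega) c hc a ha).symm
    · simpa [hik, hjk] using h.disj i (by omega) j (by omega) hij a ha c hc

protected theorem switch {u v x y : V} (h : IsDegTwoFamily G f k l) (hs : CanSwitch G u v x y)
    (hu : ∀ i < k, ∀ a < l, u ≠ f i a) (hx : ∀ i < k, ∀ a < l, x ≠ f i a) :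
    IsDegTwoFamily (switch G u v x y) f k l := by
  refine ⟨fun i hi => (h.path i hi).switch hs (fun a ha he => ?_) (fun a ha he => ?_), h.disj⟩
  · rcases Sym2.mem_iff.1 (he ▸ Sym2.mem_mk_left u v) with e | e
    exacts [hu i hi a (by omega) e, hu i hi (a + 1) ha e]
  · rcases Sym2.mem_iff.1 (he ▸ Sym2.mem_mk_left x y) with e | e
    exacts [hx i hi a (by omega) e, hx i hi (a + 1) ha e]

end IsDegTwoFamily

/-- The vertices of `q` and those from which `q` is entered at one of its ends: a path of `l`
vertices of degree `2` that meets `q` starts in this set. -/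
def feeders (G : SimpleGraph V) (q : ℕ → V) (l : ℕ) : Set V :=
  q '' Set.Iio l ∪ ray G (q 1) (q 0) l ∪ ray G (q (l - 2)) (q (l - 1)) l

theorem IsDegTwoPath.ncard_feeders_le (hq : IsDegTwoPath G q l) (hl : 2 ≤ l) :
    (feeders G q l).ncard ≤ 3 * l := by
  have hfirst := ncard_ray_le (hq.adj 0 (by omega)) l
  have hlast := ncard_ray_le (hq.reverse.adj 0 (by omega)) l
  calc (feeders G q l).ncard ≤ (q '' Set.Iio l).ncard + (ray G (q 1) (q 0) l).ncard +
        (ray G (q (l - 2)) (q (l - 1)) l).ncard := by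
        grw [feeders, Set.ncard_union_le, Set.ncard_union_le]
    _ ≤ l + l + l := by
      rw [hq.ncard_image]
      gcongr
      exact hlast
    _ = 3 * l := by ring

theorem IsDegTwoPath.eq_end_of_adj (hq : IsDegTwoPath G q l) (hj : j < l) {z : V}
    (hz : G.Adj (q j) z) (hzq : z ∉ q '' Set.Iio l) : j = 0 ∨ j = l - 1 := by
  by_contra! hj'
  obtain ⟨i, rfl⟩ := Nat.exists_eq_succ_of_ne_zero hj'.1
  have hi : i + 2 < l := by omega
  rcases hq.eq_or_eq_of_adj hi hz with rfl | rfl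
  exacts [hzq ⟨i, by simp; omega, rfl⟩, hzq ⟨i + 2, hi, rfl⟩]

theorem IsDegTwoPath.mem_feeders_of_meets (hp : IsDegTwoPath G p l) (hq : IsDegTwoPath G q l)
    (hl : 2 ≤ l) (hmeet : ∃ a, a < l ∧ p a ∈ q '' Set.Iio l) : p 0 ∈ feeders G q l := by
  classical
  obtain ⟨ha, j, hj : j < l, hja⟩ := Nat.find_spec hmeet
  have hfirst : ∀ i < Nat.find hmeet, p i ∉ q '' Set.Iio l :=
    fun i hi hpi => Nat.find_min hmeet hi ⟨by omega, hpi⟩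
  generalize Nat.find hmeet = a at ha hja hfirst
  rcases a with _ | i
  · exact Or.inl (Or.inl ⟨j, hj, hja⟩)
  have hi := hfirst i (by omega)
  have hmem : ∀ c < l, p 0 ∈ ray G (q c) (p (i + 1)) l := fun c hc =>
    (hp.mono (by omega)).mem_ray ha fun _ he => hi ⟨c, hc, he.symm⟩
  rcases hq.eq_end_of_adj hj (hja ▸ (hp.adj i ha).symm) hi with rfl | rfl
  · exact Or.inl (Or.inr (hja ▸ hmem 1 (by omega)))
  · exact Or.inr (hja ▸ hmem (l - 2) (by omega))

theorem IsDegTwoFamily.exists_succ [Finite V] (hf : IsDegTwoFamily G f k l) (hl : 2 ≤ l)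
    (hk : k * (3 * l) < (pathStarts G l).ncard) : ∃ f', IsDegTwoFamily G f' (k + 1) l := by
  have hfeed : (⋃ i ∈ Finset.range k, feeders G (f i) l).ncard < (pathStarts G l).ncard := by
    calc _ ≤ ∑ i ∈ Finset.range k, (feeders G (f i) l).ncard := Finset.set_ncard_biUnion_le _ _
      _ ≤ (Finset.range k).card * (3 * l) := Finset.sum_le_card_nsmul _ _ _ fun i hi =>
          (hf.path i (Finset.mem_range.1 hi)).ncard_feeders_le hl
      _ < (pathStarts G l).ncard := by rwa [Finset.card_range]
  obtain ⟨v, ⟨p, hp, rfl⟩, hv⟩ := Set.exists_mem_notMem_of_ncard_lt_ncard hfeed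
  refine ⟨_, hf.update hp fun i hi a ha c hc he => hv ?_⟩
  exact Set.mem_biUnion (Finset.mem_coe.2 (Finset.mem_range.2 hi))
    (hp.mem_feeders_of_meets (hf.path i hi) hl ⟨a, ha, c, hc, he.symm⟩)

theorem exists_isDegTwoFamily [Finite V] (hl : 2 ≤ l) (hk : k * (3 * l) < (pathStarts G l).ncard) :
    ∃ f, IsDegTwoFamily G f (k + 1) l := by
  induction k with
  | zero =>
    obtain ⟨v, p, hp, -⟩ := Set.nonempty_of_ncard_ne_zero (Nat.ne_zero_of_lt hk)
    exact ⟨fun _ => p, fun _ _ => hp, fun i hi j hj => by omega⟩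
  | succ k ih =>
    obtain ⟨f, hf⟩ := ih (lt_of_le_of_lt (Nat.mul_le_mul_right _ (Nat.le_succ k)) hk)
    exact hf.exists_succ hl hk

end DegTwoFamily

section LargeVertices

variable {V : Type*} {G H : SimpleGraph V} {p : ℕ → V} {k s : ℕ} {v w : V}

/-- The vertices of the components with at least `s` vertices. -/
def largeVertices (s : ℕ) (G : SimpleGraph V) : Set V :=
  {v | s ≤ (G.connectedComponentMk v).supp.ncard}

theorem mem_largeVertices_iff_of_reachable (h : G.Reachable v w) :
    v ∈ largeVertices s G ↔ w ∈ largeVertices s G := by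
  simp only [largeVertices, Set.mem_ofPred_eq, SimpleGraph.ConnectedComponent.sound h]

theorem largeVertices_subset [Finite V] (h : ∀ a b, H.Reachable a b → G.Reachable a b) :
    largeVertices s H ⊆ largeVertices s G :=
  fun v hv => le_trans hv <| Set.ncard_le_ncard fun w hw =>
    SimpleGraph.ConnectedComponent.sound (h w v (SimpleGraph.ConnectedComponent.exact hw))

theorem hasComponentOfOrderAtLeast_iff {n : ℕ} {x : ℝ} {G : SimpleGraph (Fin n)} :
    HasComponentOfOrderAtLeast x G ↔ (largeVertices ⌈x⌉₊ G).Nonempty := by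
  constructor
  · rintro ⟨c, hc⟩
    obtain ⟨v, rfl⟩ := c.exists_rep
    exact ⟨v, Nat.ceil_le.2 hc⟩
  · rintro ⟨v, hv⟩
    exact ⟨_, Nat.ceil_le.1 hv⟩

theorem IsDegTwoCycle.notMem_largeVertices (h : IsDegTwoCycle G p k) (hk : k < s)
    (hv : v ∈ p '' Set.Iio k) : v ∉ largeVertices s G := by
  have hsub : (G.connectedComponentMk v).supp ⊆ p '' Set.Iio k := by
    intro z hz
    have hvz : G.Reachable v z := (SimpleGraph.ConnectedComponent.exact hz).symm
    induction (SimpleGraph.reachable_iff_reflTransGen v z).1 hvz with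
    | refl => exact hv
    | tail hac hcd ih =>
      have hvc := (SimpleGraph.reachable_iff_reflTransGen _ _).2 hac
      exact h.mem_image_of_adj (ih (SimpleGraph.ConnectedComponent.sound hvc.symm) hvc) hcd
  have hcard := Set.ncard_le_ncard hsub
  rw [h.path.ncard_image] at hcard
  exact fun hv' => absurd (le_trans hv' hcard) hk.not_ge

end LargeVertices

section CutOff

variable {V : Type*} {G : SimpleGraph V} {p : ℕ → V} {i j l s : ℕ}

theorem IsDegTwoPath.canSwitch_cutOff (h : IsDegTwoPath G p l) (hi : 1 ≤ i) (hij : i + 3 ≤ j)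
    (hj : j + 1 < l) : CanSwitch G (p i) (p (i + 1)) (p (j + 1)) (p j) := by
  have hne : ∀ a < l, ∀ c < l, a ≠ c → p a ≠ p c := fun a ha c hc hac he => hac (h.inj a ha c hc he)
  obtain ⟨m, rfl⟩ := Nat.exists_eq_add_of_le' hi
  refine ⟨h.adj _ (by omega), (h.adj j hj).symm, fun hadj => ?_, fun hadj => ?_,
    hne _ (by omega) _ (by omega) (by omega), hne _ (by omega) _ (by omega) (by omega)⟩ <;>
  · rcases h.eq_or_eq_of_adj (by omega) hadj with e | e <;>
      exact hne _ (by omega) _ (by omega) (by omega) e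

theorem IsDegTwoPath.isDegTwoCycle_cutOff (h : IsDegTwoPath G p l) (hi : 1 ≤ i) (hij : i + 3 ≤ j)
    (hj : j + 1 < l) : IsDegTwoCycle (switch G (p i) (p (i + 1)) (p (j + 1)) (p j))
      (fun a => p (i + 1 + a)) (j - i) := by
  have hs := h.canSwitch_cutOff hi hij hj
  refine ⟨((h.drop (i + 1)).mono (by omega)).switch hs (fun a ha he => ?_) (fun a ha he => ?_),
    by omega, ?_⟩
  · have := h.eq_of_edge_eq (i := i + 1 + a) (by omega) (by omega) he
    omega
  · have := h.eq_of_edge_eq (i := i + 1 + a) (by omega) hj (he.trans Sym2.eq_swap)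
    omega
  · convert hs.adj_vy.symm using 2
    omega

theorem IsDegTwoPath.ncard_largeVertices_cutOff_le [Finite V] (h : IsDegTwoPath G p l)
    (hi : 1 ≤ i) (hij : i + 3 ≤ j) (hj : j + 1 < l) (hl : l ≤ s) (h0 : p 0 ∈ largeVertices s G) :
    (largeVertices s (switch G (p i) (p (i + 1)) (p (j + 1)) (p j))).ncard + (j - i) ≤
      (largeVertices s G).ncard := by
  have hs := h.canSwitch_cutOff hi hij hj
  have hcycle := h.isDegTwoCycle_cutOff hi hij hj
  rw [← hcycle.path.ncard_image, ← Set.ncard_union_eq]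
  · refine Set.ncard_le_ncard (Set.union_subset (largeVertices_subset fun a b => ?_) ?_)
    · exact reachable_of_reachable_switch hs.uv hs.xy (h.reachable (by omega) (by omega))
    · rintro _ ⟨a, ha, rfl⟩
      simp only [Set.mem_Iio] at ha
      exact (mem_largeVertices_iff_of_reachable (h.reachable (by omega) (by omega))).1 h0
  · exact Set.disjoint_right.2 fun v => hcycle.notMem_largeVertices (by omega)

end CutOff

section CutOffRealizations

variable {n : ℕ} {D : Fin n → ℕ} {G : SimpleGraph (Fin n)} {l s t : ℕ}

theorem exists_isDegTwoPath_of_nonempty_largeVertices (hD : ∀ i, 0 < D i)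
    (hG : G ∈ realizations D) (hl0 : 0 < l) (hl : l ≤ s) (hs : sumDegNeTwo D * (l + 1) < s)
    (hne : (largeVertices s G).Nonempty) : ∃ p, IsDegTwoPath G p l ∧ p 0 ∈ largeVertices s G := by
  obtain ⟨w, hw⟩ := hne
  let S := (G.connectedComponentMk w).supp
  have hS : S ⊆ largeVertices s G := fun v hv =>
    (mem_largeVertices_iff_of_reachable (SimpleGraph.ConnectedComponent.exact hv)).2 hw
  have hcyc : S ∩ onShortCycle G l = ∅ := by
    rw [Set.eq_empty_iff_forall_notMem]
    rintro v ⟨hv, p, k, hk, hp, rfl⟩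
    have h3 := hp.three_le
    exact hp.notMem_largeVertices (by omega) ⟨0, by simp; omega, rfl⟩ (hS hv)
  have hcard := ncard_le_add_ncard_inter_pathStarts hD hG hl0 S
  rw [hcyc, Set.ncard_empty] at hcard
  have hw' : s ≤ S.ncard := hw
  obtain ⟨v, hv, p, hp, rfl⟩ := Set.nonempty_of_ncard_ne_zero
    (show (S ∩ pathStarts G l).ncard ≠ 0 by omega)
  exact ⟨p, hp, hS hv⟩

theorem mul_self_le_ncard_switchesInto_of_nonempty_largeVertices (hD : ∀ i, 0 < D i)
    (hG : G ∈ realizations D) (ht : 3 ≤ t) (hs : (sumDegNeTwo D + 1) * (3 * t + 2) ≤ s)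
    (hne : (largeVertices s G).Nonempty) :
    t * t ≤ (switchesInto {H ∈ realizations D |
      (largeVertices s H).ncard + t ≤ (largeVertices s G).ncard} G).ncard := by
  rw [add_one_mul] at hs
  obtain ⟨p, hp, h0⟩ := exists_isDegTwoPath_of_nonempty_largeVertices (l := 3 * t + 1) hD hG
    (by omega) (by omega) (show sumDegNeTwo D * (3 * t + 2) < s by omega) hne
  refine mul_self_le_ncard (i := 1) (j := 2 * t) hp.injOn hp.injOn (by omega) (by omega)
    fun a ha b hb => ?_
  have hswitch := hp.canSwitch_cutOff (i := 1 + a) (j := 2 * t + b) (by omega) (by omega) (by omega)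
  have hcut := hp.ncard_largeVertices_cutOff_le (i := 1 + a) (j := 2 * t + b) (s := s)
    (by omega) (by omega) (by omega) (by omega) h0
  exact ⟨hswitch, hswitch.switch_mem_realizations hG, le_trans (by omega) hcut⟩

theorem ncard_realizations_le_mul_ncard_not_hasComponent {C J : ℕ} {x : ℝ} (hD : ∀ i, 0 < D i)
    (ht : 3 ≤ t) (hx : (sumDegNeTwo D + 1) * (3 * t + 2) ≤ ⌈x⌉₊)
    (hC : (∑ i, D i) * ∑ i, D i ≤ C * (t * t)) (hJ : n ≤ J * t) :
    (realizations D).ncard ≤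
      (1 + C) ^ J * (realizations D ∩ {G | ¬ HasComponentOfOrderAtLeast x G}).ncard := by
  let A (j : ℕ) : Set (SimpleGraph (Fin n)) :=
    {G ∈ realizations D | (largeVertices ⌈x⌉₊ G).ncard ≤ j * t}
  have hstep (j : ℕ) : (A (j + 1) \ A j).ncard ≤ C * (A j).ncard := by
    refine ncard_le_mul_of_switch (fun G hG => hG.1) (by omega) hC ?_
    rintro G ⟨⟨hG, hle⟩, hnot⟩
    have hlt : j * t < (largeVertices ⌈x⌉₊ G).ncard := not_le.1 fun h => hnot ⟨hG, h⟩
    refine (mul_self_le_ncard_switchesInto_of_nonempty_largeVertices hD hG ht hx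
      (Set.nonempty_of_ncard_ne_zero (by omega))).trans (Set.ncard_le_ncard ?_)
    rintro q ⟨hs, hq, hcut⟩
    rw [add_one_mul] at hle
    exact ⟨hs, hq, by omega⟩
  have hlast : realizations D ⊆ A J := fun G hG =>
    ⟨hG, (Set.ncard_le_card _).trans (by simpa using hJ)⟩
  have hzero : A 0 ⊆ realizations D ∩ {G | ¬ HasComponentOfOrderAtLeast x G} := by
    rintro G ⟨hG, h⟩
    rw [zero_mul, Nat.le_zero, Set.ncard_eq_zero] at h
    simpa [hasComponentOfOrderAtLeast_iff, h] using hG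
  calc (realizations D).ncard ≤ (A J).ncard := Set.ncard_le_ncard hlast
    _ ≤ (1 + C) ^ J * (A 0).ncard := ncard_le_pow_mul_of_ncard_diff_le hstep J
    _ ≤ _ := Nat.mul_le_mul_left _ (Set.ncard_le_ncard hzero)

end CutOffRealizations

section OpenCycle

variable {V : Type*} {G : SimpleGraph V} {p : ℕ → V} {k : ℕ} {v x y : V}

namespace IsDegTwoCycle

theorem notMem_image_of_adj (h : IsDegTwoCycle G p k) (hxy : G.Adj x y)
    (hx : x ∉ p '' Set.Iio k) : y ∉ p '' Set.Iio k :=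
  fun hy => hx (h.mem_image_of_adj hy hxy.symm)

theorem canSwitch (h : IsDegTwoCycle G p k) (hxy : G.Adj x y) (hx : x ∉ p '' Set.Iio k) :
    CanSwitch G (p 0) (p (k - 1)) x y := by
  have h3 := h.three_le
  have hfirst : p 0 ∈ p '' Set.Iio k := ⟨0, by simp; omega, rfl⟩
  have hlast : p (k - 1) ∈ p '' Set.Iio k := ⟨k - 1, by simp; omega, rfl⟩
  have hy := h.notMem_image_of_adj hxy hx
  exact ⟨h.close.symm, hxy, fun hadj => hx (h.mem_image_of_adj hfirst hadj),
    fun hadj => hy (h.mem_image_of_adj hlast hadj), ne_of_mem_of_not_mem hfirst hx,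
    ne_of_mem_of_not_mem hlast hy⟩

theorem isDegTwoPath_switch (h : IsDegTwoCycle G p k) (hxy : G.Adj x y)
    (hx : x ∉ p '' Set.Iio k) : IsDegTwoPath (switch G (p 0) (p (k - 1)) x y) p k := by
  have h3 := h.three_le
  refine h.path.switch (h.canSwitch hxy hx) (fun i hi he => ?_) (fun i hi he => ?_)
  · rcases Sym2.eq_iff.1 he with ⟨e, e'⟩ | ⟨-, e⟩
    · have := h.path.inj _ (by omega) _ (by omega) e
      have := h.path.inj _ (by omega) _ (by omega) e'
      omega
    · have := h.path.inj _ (by omega) _ (by omega) e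
      omega
  · rcases Sym2.mem_iff.1 (he ▸ Sym2.mem_mk_left x y) with e | e
    exacts [hx ⟨i, by simp; omega, e.symm⟩, hx ⟨i + 1, hi, e.symm⟩]

end IsDegTwoCycle

/-- The triples `(w, x, y)` for which some path of `k` vertices of degree `2` leads from `v` to `w`
and continues to `x` beyond `v` and to `y` beyond `w`. -/
def pathEnds (G : SimpleGraph V) (v : V) (k : ℕ) : Set (V × V × V) :=
  {(w, x, y) | ∃ p, IsDegTwoPath G p k ∧ p 0 = v ∧ p (k - 1) = w ∧
    (G.Adj v x ∧ p 1 ≠ x) ∧ G.Adj w y ∧ p (k - 2) ≠ y}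

theorem injOn_pathEnds (hk : 2 ≤ k) : Set.InjOn (fun e => e.2.1) (pathEnds G v k) := by
  rintro ⟨w, x, y⟩ ⟨p, hp, hp0, rfl, ⟨hx, hpx⟩, hy, hpy⟩ ⟨w', x', y'⟩
    ⟨q, hq, hq0, rfl, ⟨-, hqx⟩, hy', hqy⟩ (rfl : x = x')
  have hpq := hp.eq_of_adj_of_ne hq (hp0.trans hq0.symm) (hp0 ▸ hx) (fun _ => hpx) fun _ => hqx
  rw [← hpq _ (by omega)] at hy' hqy ⊢
  have hprev : G.Adj (p (k - 1)) (p (k - 2)) := by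
    simpa [show k - 2 + 1 = k - 1 by omega] using (hp.adj (k - 2) (by omega)).symm
  rw [(eq_or_eq_of_adj_of_adj (hp.deg _ (by omega)) hprev hy hpy hy').resolve_left hqy.symm]

theorem ncard_pathEnds_le [Finite V] (hk : 2 ≤ k) : (pathEnds G v k).ncard ≤ 2 := by
  rcases Set.eq_empty_or_nonempty (pathEnds G v k) with he | ⟨_, p, hp, rfl, -⟩
  · simp [he]
  · rw [← hp.deg 0 (by omega)]
    refine Set.ncard_le_ncard_of_injOn _ ?_ (injOn_pathEnds hk)
    rintro e ⟨q, -, -, -, h, -⟩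
    exact h.1

end OpenCycle

section ShortCycles

variable {n : ℕ} {D : Fin n → ℕ} {l : ℕ}

/-- The realizations in which `v` lies on a cycle of `k` vertices of degree `2`. -/
def cycleThrough (D : Fin n → ℕ) (v : Fin n) (k : ℕ) : Set (SimpleGraph (Fin n)) :=
  {G ∈ realizations D | ∃ p, IsDegTwoCycle G p k ∧ p 0 = v}

-- A switch with an edge `xy` off the cycle opens it at `v`. The resulting path has only two
-- possible positions, one for each direction in which it can leave `v`.
theorem ncard_cycleThrough_mul_le (hD : ∀ i, 0 < D i) (v : Fin n) {k : ℕ} (hk : 3 ≤ k) :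
    (cycleThrough D v k).ncard * (n - k) ≤ (realizations D).ncard * 2 := by
  refine ncard_mul_le_ncard_mul_of_labels (fun G (w, x, y) H => ∃ p, IsDegTwoCycle G p k ∧
    p 0 = v ∧ p (k - 1) = w ∧ G.Adj x y ∧ x ∉ p '' Set.Iio k ∧ switch G v w x y = H) ?_ ?_ ?_
  · rintro G ⟨hG, p, hp, rfl⟩
    have hnb : ∀ x, ∃ y, G.Adj x y := fun x =>
      Set.nonempty_of_ncard_ne_zero ((hG x).trans_ne (hD x).ne')
    choose nb hnb using hnb
    calc n - k = (p '' Set.Iio k)ᶜ.ncard := by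
          rw [Set.ncard_compl, hp.path.ncard_image, Nat.card_fin]
      _ ≤ _ := by
          refine Set.ncard_le_ncard_of_injOn (fun x => (p (k - 1), x, nb x)) (fun x hx => ?_)
            fun x _ x' _ he => by simp_all only [Prod.mk.injEq]
          exact ⟨_, (hp.canSwitch (hnb x) hx).switch_mem_realizations hG, p, hp, rfl, rfl, hnb x,
            hx, rfl⟩
  · intro H _
    refine (Set.ncard_le_ncard ?_).trans
      (ncard_pathEnds_le (G := H) (v := v) (k := k) (by omega))
    rintro ⟨w, x, y⟩ ⟨G, -, p, hp, rfl, rfl, hxy, hx, rfl⟩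
    have hs := hp.canSwitch hxy hx
    exact ⟨p, hp.isDegTwoPath_switch hxy hx, rfl, rfl,
      ⟨hs.adj_ux, fun e => hx ⟨1, by simp; omega, e⟩⟩, hs.adj_vy,
      fun e => hp.notMem_image_of_adj hxy hx ⟨k - 2, by simp; omega, e⟩⟩
  · rintro G G' ⟨w, x, y⟩ H ⟨p, hp, rfl, rfl, hxy, hx, h⟩ ⟨q, hq, hq0, hqk, hxy', hx', h'⟩
    have hs := hp.canSwitch hxy hx
    have hs' := hq.canSwitch hxy' hx'
    rw [hq0, hqk] at hs'
    rw [← hs.switch_switch, ← hs'.switch_switch, h, h']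

theorem ncard_mem_onShortCycle_le (hD : ∀ i, 0 < D i) (hl : 32 * l ≤ n) (v : Fin n) :
    8 * {G ∈ realizations D | v ∈ onShortCycle G l}.ncard ≤ (realizations D).ncard := by
  have hcycle : ∀ k ∈ Finset.Ico 3 l,
      n * (cycleThrough D v k).ncard ≤ 4 * (realizations D).ncard := fun k hk => by
    have hk := Finset.mem_Ico.1 hk
    calc n * (cycleThrough D v k).ncard ≤ 2 * (n - k) * (cycleThrough D v k).ncard :=
          Nat.mul_le_mul_right _ (by omega)
      _ = 2 * ((cycleThrough D v k).ncard * (n - k)) := by ring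
      _ ≤ 2 * ((realizations D).ncard * 2) :=
          Nat.mul_le_mul_left _ (ncard_cycleThrough_mul_le hD v hk.1)
      _ = 4 * (realizations D).ncard := by ring
  have hsub : {G ∈ realizations D | v ∈ onShortCycle G l} ⊆
      ⋃ k ∈ Finset.Ico 3 l, cycleThrough D v k := by
    rintro G ⟨hG, p, k, hk, hp⟩
    exact Set.mem_biUnion (Finset.mem_coe.2 (Finset.mem_Ico.2 ⟨hp.1.three_le, hk⟩)) ⟨hG, p, hp⟩
  refine Nat.le_of_mul_le_mul_left ?_ v.pos
  calc n * (8 * {G ∈ realizations D | v ∈ onShortCycle G l}.ncard)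
      ≤ n * (8 * ∑ k ∈ Finset.Ico 3 l, (cycleThrough D v k).ncard) := by
        gcongr
        exact (Set.ncard_le_ncard hsub).trans (Finset.set_ncard_biUnion_le _ _)
    _ = 8 * ∑ k ∈ Finset.Ico 3 l, n * (cycleThrough D v k).ncard := by
        rw [← Finset.mul_sum]
        ring
    _ ≤ 8 * (l * (4 * (realizations D).ncard)) := by
        gcongr
        refine (Finset.sum_le_card_nsmul _ _ _ hcycle).trans (Nat.mul_le_mul_right _ ?_)
        simp
    _ = 32 * l * (realizations D).ncard := by ring
    _ ≤ n * (realizations D).ncard := Nat.mul_le_mul_right _ hl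

theorem two_mul_ncard_many_onShortCycle_le (hD : ∀ i, 0 < D i) (hn : 0 < n) (hl : 32 * l ≤ n) :
    2 * {G ∈ realizations D | n < 4 * (onShortCycle G l).ncard}.ncard ≤
      (realizations D).ncard := by
  classical
  let R := (realizations D).ncard
  let B := {G ∈ realizations D | n < 4 * (onShortCycle G l).ncard}
  have hcount :
      B.toFinset.card * ((n + 3) / 4) ≤ (Finset.univ : Finset (Fin n)).card * (R / 8) := by
    refine Finset.card_mul_le_card_mul (fun G v => v ∈ onShortCycle G l) (fun G hG => ?_)
      fun v _ => ?_
    · have hmany : n < 4 * (onShortCycle G l).ncard := (Set.mem_toFinset.1 hG).2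
      have : Finset.univ.bipartiteAbove (fun G v => v ∈ onShortCycle G l) G =
          (onShortCycle G l).toFinset := by
        ext; simp [Finset.bipartiteAbove]
      rw [this, ← Set.ncard_eq_toFinset_card']
      omega
    · rw [Nat.le_div_iff_mul_le (by norm_num), mul_comm]
      refine le_trans (Nat.mul_le_mul_left 8 ?_) (ncard_mem_onShortCycle_le hD hl v)
      rw [Set.ncard_eq_toFinset_card']
      refine Finset.card_le_card fun G hG => ?_
      simp only [Finset.bipartiteBelow, Finset.mem_filter, Set.mem_toFinset] at hG
      exact Set.mem_toFinset.2 ⟨hG.1.1, hG.2⟩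
  rw [Finset.card_fin, ← Set.ncard_eq_toFinset_card'] at hcount
  refine Nat.le_of_mul_le_mul_left ?_ hn
  calc n * (2 * B.ncard) ≤ 4 * ((n + 3) / 4) * (2 * B.ncard) := by
        gcongr
        omega
    _ = 8 * (B.ncard * ((n + 3) / 4)) := by ring
    _ ≤ 8 * (n * (R / 8)) := Nat.mul_le_mul_left _ hcount
    _ = n * (R / 8 * 8) := by ring
    _ ≤ n * R := Nat.mul_le_mul_left _ (Nat.div_mul_le_self _ _)

theorem ncard_realizations_le_two_mul_ncard_few_onShortCycle (hD : ∀ i, 0 < D i) (hn : 0 < n)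
    (hl : 32 * l ≤ n) : (realizations D).ncard ≤
      2 * {G ∈ realizations D | 4 * (onShortCycle G l).ncard ≤ n}.ncard := by
  have hmany := two_mul_ncard_many_onShortCycle_le hD hn hl
  have hsub : realizations D ⊆ {G ∈ realizations D | 4 * (onShortCycle G l).ncard ≤ n} ∪
      {G ∈ realizations D | n < 4 * (onShortCycle G l).ncard} := fun G hG =>
    (le_or_gt _ _).imp (⟨hG, ·⟩) (⟨hG, ·⟩)
  have hsplit := (Set.ncard_le_ncard hsub).trans (Set.ncard_union_le _ _)
  omega

end ShortCycles

section Merge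

variable {V : Type*} {G : SimpleGraph V} {p q : ℕ → V} {i j l m : ℕ}

namespace IsDegTwoPath

theorem canSwitch_merge (hp : IsDegTwoPath G p m) (hq : IsDegTwoPath G q l)
    (hpq : ∀ a < m, ∀ c < l, p a ≠ q c) (hi : 1 ≤ i) (him : i + 2 < m) (hj : j + 1 < l) :
    CanSwitch G (p i) (p (i + 1)) (q (j + 1)) (q j) := by
  obtain ⟨r, rfl⟩ := Nat.exists_eq_add_of_le' hi
  refine ⟨hp.adj _ (by omega), (hq.adj j hj).symm, fun hadj => ?_, fun hadj => ?_,
    hpq _ (by omega) _ hj, hpq _ (by omega) _ (by omega)⟩ <;>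
  · rcases hp.eq_or_eq_of_adj (by omega) hadj with e | e <;>
      exact hpq _ (by omega) _ (by omega) e.symm

theorem merge (hp : IsDegTwoPath G p m) (hq : IsDegTwoPath G q l)
    (hpq : ∀ a < m, ∀ c < l, p a ≠ q c) (hi : 1 ≤ i) (him : i + 2 < m) (hj : j + 1 < l) :
    IsDegTwoPath (RandomDegreeGraph.switch G (p i) (p (i + 1)) (q (j + 1)) (q j))
      (fun s => if s < i + 1 then p s else q (j + 1 + (s - (i + 1)))) (i + 1 + (l - (j + 1))) := by
  have hs := hp.canSwitch_merge hq hpq hi him hj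
  refine ((hp.mono (by omega)).switch hs (fun a ha he => ?_) fun a ha he => ?_).append
    ((hq.drop (j + 1)).switch hs (fun a ha he => ?_) fun a ha he => ?_)
    (by simpa using hs.adj_ux) fun a ha c hc => hpq _ (by omega) _ (by omega)
  · have := hp.eq_of_edge_eq (by omega) (by omega) he
    omega
  · rcases Sym2.mem_iff.1 (he ▸ Sym2.mem_mk_left (p a) (p (a + 1))) with e | e <;>
      exact hpq _ (by omega) _ (by omega) e
  · rcases Sym2.mem_iff.1 (he.symm ▸ Sym2.mem_mk_left (p i) (p (i + 1))) with e | e <;>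
      exact hpq _ (by omega) _ (by omega) e
  · have := hq.eq_of_edge_eq (i := j + 1 + a) (by omega) hj (he.trans Sym2.eq_swap)
    omega

theorem le_ncard_supp [Finite V] (hp : IsDegTwoPath G p m) (hm : 0 < m) :
    m ≤ (G.connectedComponentMk (p 0)).supp.ncard := by
  have hsub : p '' Set.Iio m ⊆ (G.connectedComponentMk (p 0)).supp := by
    rintro _ ⟨a, ha, rfl⟩
    exact SimpleGraph.ConnectedComponent.sound (hp.reachable ha hm)
  simpa [hp.ncard_image] using Set.ncard_le_ncard hsub

end IsDegTwoPath

end Merge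

section MergeRealizations

variable {n : ℕ} {D : Fin n → ℕ} {G : SimpleGraph (Fin n)} {k l m t C : ℕ}

/-- The realizations containing a path of `m` vertices of degree `2` and `k` paths of `l` vertices
of degree `2`, all of them disjoint: the stage of the merging process in which `k` paths are
still to be merged into the long one. -/
def pathWithFamily (D : Fin n → ℕ) (l k m : ℕ) : Set (SimpleGraph (Fin n)) :=
  {G ∈ realizations D | ∃ p f, IsDegTwoPath G p m ∧ IsDegTwoFamily G f k l ∧
    ∀ i < k, ∀ a < m, ∀ c < l, p a ≠ f i c}

theorem IsDegTwoFamily.mem_pathWithFamily {f : ℕ → ℕ → Fin n} (hf : IsDegTwoFamily G f (k + 1) l)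
    (hG : G ∈ realizations D) : G ∈ pathWithFamily D l k l :=
  ⟨hG, f k, f, hf.path k (by omega), hf.mono (by omega),
    fun i hi => hf.disj k (by omega) i (by omega) (by omega)⟩

theorem mul_self_le_ncard_switchesInto_pathWithFamily (hG : G ∈ pathWithFamily D l (k + 1) m)
    (hm : t + 3 ≤ m) (hl : 2 * t + 1 ≤ l) :
    t * t ≤ (switchesInto (pathWithFamily D l k (m + (l - (2 * t + 1)))) G).ncard := by
  obtain ⟨hG, p, f, hp, hf, hpf⟩ := hG
  have hq := hf.path k (by omega)
  have hpq := hpf k (by omega)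
  have hfq : ∀ i < k, ∀ a < l, ∀ c < l, f k a ≠ f i c := fun i hi =>
    hf.disj k (by omega) i (by omega) (by omega)
  refine mul_self_le_ncard (i := m - (t + 2)) (j := 0) hp.injOn hq.injOn (by omega) (by omega)
    fun a ha c hc => ?_
  have hs := hp.canSwitch_merge hq hpq (i := m - (t + 2) + a) (j := 0 + c) (by omega) (by omega)
    (by omega)
  have hmerge := hp.merge hq hpq (i := m - (t + 2) + a) (j := 0 + c) (by omega) (by omega)
    (by omega)
  refine ⟨hs, hs.switch_mem_realizations hG, _, f, hmerge.mono (by omega),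
    (hf.mono (by omega)).switch hs (fun i hi => hpf i (by omega) _ (by omega))
      fun i hi => hfq i hi _ (by omega), fun i hi s hs d hd => ?_⟩
  split_ifs
  exacts [hpf i (by omega) _ (by omega) d hd, hfq i hi _ (by omega) d hd]

theorem ncard_pathWithFamily_le (ht : 0 < t) (hm : t + 3 ≤ m) (hl : 2 * t + 1 ≤ l)
    (hC : (∑ i, D i) * ∑ i, D i ≤ C * (t * t)) : (pathWithFamily D l k m).ncard ≤
      C ^ k * (pathWithFamily D l 0 (m + k * (l - (2 * t + 1)))).ncard := by
  induction k generalizing m with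
  | zero => simp
  | succ k ih =>
    calc (pathWithFamily D l (k + 1) m).ncard
        ≤ C * (pathWithFamily D l k (m + (l - (2 * t + 1)))).ncard :=
          ncard_le_mul_of_switch (fun G hG => hG.1) ht hC fun G hG =>
            mul_self_le_ncard_switchesInto_pathWithFamily hG hm hl
      _ ≤ C * (C ^ k * _) := Nat.mul_le_mul_left _ (ih (by omega))
      _ = C ^ (k + 1) * (pathWithFamily D l 0 (m + (k + 1) * (l - (2 * t + 1)))).ncard := by
          ring_nf

theorem mem_pathWithFamily_of_few_onShortCycle (hD : ∀ i, 0 < D i) (hG : G ∈ realizations D)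
    (hl : 2 ≤ l) (hk : sumDegNeTwo D * (l + 1) + n / 4 + k * (3 * l) < n)
    (hcyc : 4 * (onShortCycle G l).ncard ≤ n) : G ∈ pathWithFamily D l k l := by
  have hstarts := ncard_le_add_ncard_inter_pathStarts hD hG (by omega : 0 < l) Set.univ
  rw [Set.univ_inter, Set.univ_inter, Set.ncard_univ, Nat.card_fin] at hstarts
  obtain ⟨f, hf⟩ := exists_isDegTwoFamily (G := G) (k := k) hl (by omega)
  exact hf.mem_pathWithFamily hG

theorem ncard_realizations_le_mul_ncard_hasComponent {x : ℝ} (hD : ∀ i, 0 < D i) (ht : 0 < t)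
    (hlt : 2 * t + 4 ≤ l) (hl : 32 * l ≤ n)
    (hk : sumDegNeTwo D * (l + 1) + n / 4 + k * (3 * l) < n)
    (hC : (∑ i, D i) * ∑ i, D i ≤ C * (t * t))
    (hx : x ≤ ((l + k * (l - (2 * t + 1)) : ℕ) : ℝ)) :
    (realizations D).ncard ≤
      2 * C ^ k * (realizations D ∩ {G | HasComponentOfOrderAtLeast x G}).ncard := by
  have hfew : {G ∈ realizations D | 4 * (onShortCycle G l).ncard ≤ n} ⊆ pathWithFamily D l k l :=
    fun G hG => mem_pathWithFamily_of_few_onShortCycle hD hG.1 (by omega) hk hG.2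
  have hlarge : pathWithFamily D l 0 (l + k * (l - (2 * t + 1))) ⊆
      realizations D ∩ {G | HasComponentOfOrderAtLeast x G} := by
    rintro G ⟨hG, p, -, hp, -⟩
    exact ⟨hG, _, hx.trans (Nat.cast_le.2 (hp.le_ncard_supp (by omega)))⟩
  calc (realizations D).ncard
      ≤ 2 * {G ∈ realizations D | 4 * (onShortCycle G l).ncard ≤ n}.ncard :=
        ncard_realizations_le_two_mul_ncard_few_onShortCycle hD (by omega) hl
    _ ≤ 2 * (pathWithFamily D l k l).ncard := Nat.mul_le_mul_left _ (Set.ncard_le_ncard hfew)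
    _ ≤ 2 * (C ^ k * (pathWithFamily D l 0 (l + k * (l - (2 * t + 1)))).ncard) :=
        Nat.mul_le_mul_left _ (ncard_pathWithFamily_le ht (by omega) (by omega) hC)
    _ ≤ 2 * (C ^ k * (realizations D ∩ {G | HasComponentOfOrderAtLeast x G}).ncard) :=
        Nat.mul_le_mul_left _ (Nat.mul_le_mul_left _ (Set.ncard_le_ncard hlarge))
    _ = 2 * C ^ k * (realizations D ∩ {G | HasComponentOfOrderAtLeast x G}).ncard :=
        (mul_assoc _ _ _).symm

end MergeRealizations

section Probability

variable {n : ℕ} {D : Fin n → ℕ} {P : SimpleGraph (Fin n) → Prop}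

theorem sum_le_sumDegNeTwo_add (D : Fin n → ℕ) : ∑ i, D i ≤ sumDegNeTwo D + 2 * n := by
  rw [sumDegNeTwo, ← Finset.sum_filter_add_sum_filter_not Finset.univ (fun i => D i ≠ 2)]
  refine Nat.add_le_add_left ?_ _
  calc ∑ i with ¬ D i ≠ 2, D i
      ≤ (Finset.univ.filter fun i => ¬ D i ≠ 2).card • 2 :=
        Finset.sum_le_card_nsmul _ _ 2 fun i hi => (not_not.1 (Finset.mem_filter.1 hi).2).le
    _ ≤ n • 2 := nsmul_le_nsmul_left (Nat.zero_le 2) (card_finset_fin_le _)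
    _ = 2 * n := by rw [smul_eq_mul, mul_comm]

theorem le_two_mul_mul_div {B : ℕ} (hB : 0 < B) (hn : B ≤ n) : n ≤ 2 * (B * (n / B)) := by
  have hquot : B * 1 ≤ B * (n / B) := Nat.mul_le_mul_left B ((Nat.one_le_div_iff hB).2 hn)
  have hdiv := Nat.div_add_mod n B
  have hmod := Nat.mod_lt n hB
  omega

theorem sum_mul_sum_le {B : ℕ} (hB : 0 < B) (hn : B ≤ n) (hM : sumDegNeTwo D ≤ n) :
    (∑ i, D i) * ∑ i, D i ≤ 36 * B ^ 2 * ((n / B) * (n / B)) := by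
  have hsum : ∑ i, D i ≤ 6 * (B * (n / B)) := by
    have := sum_le_sumDegNeTwo_add D
    have := le_two_mul_mul_div hB hn
    omega
  exact (Nat.mul_le_mul hsum hsum).trans_eq (by ring)

theorem inv_le_prob {c : ℕ} (hF : Feasible D)
    (h : (realizations D).ncard ≤ c * (realizations D ∩ {G | P G}).ncard) :
    (c : ℝ)⁻¹ ≤ prob D P := by
  have hR : 0 < (realizations D).ncard := (Set.ncard_pos (Set.toFinite _)).2 hF
  have hc : 0 < c := Nat.pos_of_mul_pos_right (hR.trans_le h)
  rw [prob, inv_eq_one_div, div_le_div_iff₀ (by positivity) (by positivity), one_mul, mul_comm]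
  exact_mod_cast h

theorem prob_add_prob_not (hF : Feasible D) : prob D P + prob D (fun G => ¬ P G) = 1 := by
  have hR : 0 < (realizations D).ncard := (Set.ncard_pos (Set.toFinite _)).2 hF
  rw [prob, prob, ← add_div, div_eq_one_iff_eq (by positivity)]
  exact_mod_cast Set.ncard_inter_add_ncard_sdiff_eq_ncard (realizations D) {G | P G}
    (Set.toFinite _)

theorem exists_merge_length {M K n : ℕ} (hM : M + 5 ≤ K) (hn : 200 * (K + 1) ≤ n) :
    ∃ l, 2 * (n / (96 * (K + 1))) + 4 ≤ l ∧ 32 * l ≤ n ∧ M * (l + 1) + n / 4 + K * (3 * l) < n ∧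
      n ≤ 8 * (l + K * (l - (2 * (n / (96 * (K + 1))) + 1))) := by
  set t := n / (96 * (K + 1))
  set l := n / (6 * (K + 1))
  have hl : 6 * (K + 1) * l ≤ n := Nat.mul_div_le _ _
  have hl' : n < 6 * (K + 1) * (l + 1) := Nat.lt_mul_div_succ n (by positivity)
  have ht : 96 * (K + 1) * t ≤ n := Nat.mul_div_le _ _
  rw [mul_assoc, add_one_mul] at hl hl' ht
  rw [mul_add_one] at hl'
  have hM' : M * l + 5 * l ≤ K * l := by rw [← add_mul]; exact Nat.mul_le_mul_right _ hM
  have hlt : 2 * t + 4 ≤ l := by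
    by_contra! hlt
    have : K * l ≤ K * (2 * t + 3) := Nat.mul_le_mul_left _ (by omega)
    have : K * (2 * t + 3) = 2 * (K * t) + 3 * K := by ring
    omega
  refine ⟨l, hlt, by omega, ?_, ?_⟩
  · rw [mul_add_one, mul_left_comm]
    omega
  · obtain ⟨d, hd⟩ := Nat.exists_eq_add_of_le (by omega : 2 * t + 1 ≤ l)
    have : K * l = 2 * (K * t) + K + K * d := by rw [hd]; ring
    rw [hd, Nat.add_sub_cancel_left]
    omega

theorem exists_pos_le_prob_hasComponent (β : ℕ) {γ : ℝ} (hγ : γ < 1 / 8) :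
    ∃ δ > 0, ∃ N, ∀ (n : ℕ) (D : Fin n → ℕ), N ≤ n → (∀ i, 0 < D i) → Feasible D →
      sumDegNeTwo D ≤ β → δ ≤ prob D (HasComponentOfOrderAtLeast (γ * n)) := by
  refine ⟨((2 * (36 * (96 * (β + 5 + 1)) ^ 2) ^ (β + 5) : ℕ) : ℝ)⁻¹, by positivity,
    200 * (β + 5 + 1), fun n D hn hD hF hM => inv_le_prob hF ?_⟩
  obtain ⟨l, hlt, hln, hk, hl⟩ := exists_merge_length (Nat.add_le_add_right hM 5) hn
  refine ncard_realizations_le_mul_ncard_hasComponent hD (Nat.div_pos (by omega) (by omega))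
    hlt hln hk (sum_mul_sum_le (by omega) (by omega) (by omega)) ?_
  have hl' := Nat.cast_le (α := ℝ).2 hl
  have hγn : γ * n ≤ 1 / 8 * n := mul_le_mul_of_nonneg_right hγ.le (Nat.cast_nonneg n)
  rw [Nat.cast_mul, Nat.cast_ofNat] at hl'
  linarith

theorem exists_pos_le_prob_not_hasComponent (β : ℕ) {γ : ℝ} (hγ : 0 < γ) :
    ∃ δ > 0, ∃ N, ∀ (n : ℕ) (D : Fin n → ℕ), N ≤ n → (∀ i, 0 < D i) → Feasible D →
      sumDegNeTwo D ≤ β → δ ≤ prob D (fun G => ¬ HasComponentOfOrderAtLeast (γ * n) G) := by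
  obtain ⟨B, hB⟩ := exists_nat_ge (5 * (β + 1) / γ)
  have hBpos : 0 < B := Nat.cast_pos.1 ((by positivity : 0 < 5 * (β + 1) / γ).trans_le hB)
  rw [div_le_iff₀ hγ] at hB
  refine ⟨(((1 + 36 * B ^ 2) ^ (2 * B) : ℕ) : ℝ)⁻¹, by positivity, 3 * B + β,
    fun n D hn hD hF hM => inv_le_prob hF ?_⟩
  have ht : 3 ≤ n / B := (Nat.le_div_iff_mul_le hBpos).2 (by omega)
  refine ncard_realizations_le_mul_ncard_not_hasComponent hD ht ?_
    (sum_mul_sum_le hBpos (by omega) (by omega))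
    ((le_two_mul_mul_div hBpos (by omega)).trans_eq (mul_assoc _ _ _).symm)
  have hlen : (sumDegNeTwo D + 1) * (3 * (n / B) + 2) ≤ (5 * (β + 1)) * (n / B) := by
    calc (sumDegNeTwo D + 1) * (3 * (n / B) + 2) ≤ (β + 1) * (5 * (n / B)) :=
          Nat.mul_le_mul (by omega) (by omega)
      _ = (5 * (β + 1)) * (n / B) := by ring
  refine Nat.cast_le.1 (?_ : (_ : ℝ) ≤ _)
  calc (((sumDegNeTwo D + 1) * (3 * (n / B) + 2) : ℕ) : ℝ)
      ≤ 5 * (β + 1) * (n / B : ℕ) := by exact_mod_cast hlen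
    _ ≤ B * γ * (n / B : ℕ) := mul_le_mul_of_nonneg_right hB (Nat.cast_nonneg _)
    _ = γ * (B * (n / B) : ℕ) := by push_cast; ring
    _ ≤ γ * n := mul_le_mul_of_nonneg_left (Nat.cast_le.2 (Nat.mul_div_le n B)) hγ.le
    _ ≤ ⌈γ * n⌉₊ := Nat.le_ceil _

end Probability

end RandomDegreeGraph

open RandomDegreeGraph in
theorem theorem6 (b : ℝ) (hb : 0 ≤ b) (γ : ℝ) (hγ0 : 0 < γ) (hγ : γ < 1 / 8) :
    ∃ (N : ℕ) (δ : ℝ), 0 < N ∧ 0 < δ ∧ δ < 1 ∧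
      ∀ (n : ℕ) (D : Fin n → ℕ), N < n → (∀ i, 0 < D i) → RandomDegreeGraph.Feasible D →
        (RandomDegreeGraph.sumDegNeTwo D : ℝ) ≤ b →
        δ ≤ RandomDegreeGraph.prob D
              (RandomDegreeGraph.HasComponentOfOrderAtLeast (γ * (n : ℝ))) ∧
        RandomDegreeGraph.prob D
            (RandomDegreeGraph.HasComponentOfOrderAtLeast (γ * (n : ℝ))) ≤ 1 - δ := by
  obtain ⟨β, hβ⟩ := exists_nat_ge b
  obtain ⟨δ, hδ, N, hlarge⟩ := exists_pos_le_prob_hasComponent β hγ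
  obtain ⟨δ', hδ', N', hsmall⟩ := exists_pos_le_prob_not_hasComponent β hγ0
  refine ⟨N + N' + 1, min (min δ δ') (1 / 2), by omega, by positivity,
    (min_le_right _ _).trans_lt (by norm_num), fun n D hn hD hF hM => ?_⟩
  have hMβ : sumDegNeTwo D ≤ β := Nat.cast_le.1 (hM.trans hβ)
  have hP := hlarge n D (by omega) hD hF hMβ
  have hnotP := hsmall n D (by omega) hD hF hMβ
  have hδδ' : min (min δ δ') (1 / 2) ≤ min δ δ' := min_le_left _ _
  refine ⟨hδδ'.trans ((min_le_left _ _).trans hP), ?_⟩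
  linarith [prob_add_prob_not (P := HasComponentOfOrderAtLeast (γ * n)) hF, min_le_right δ δ']
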